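/- Let $p$ be an odd prime, $k\ge 1$, $q=p^k$, and let $\varphi:x\mapsto x^p$ be the Frobenius automorphism of $\mathbb{F}_q$. Let $\Gamma\mathrm{L}(2,q)=\mathrm{GL}(2,q)\rtimes\langle\varphi\rangle$, where $\varphi$ acts on matrices entrywise, act on the set $\Omega$ of non-zero vectors of $\mathbb{F}_q^2$ by $(A\varphi^i)v=A\,v^{\varphi^i}$, with $\varphi^i$ applied entrywise to $v$. A set $\mathcal F\subseteq\Gamma\mathrm{L}(2,q)$ is intersecting if for all $g,h\in\mathcal F$ there is $v\in\Omega$ with $g(v)=h(v)$; it is a maximum intersecting set if it is intersecting and no intersecting set has more elements. Fix a generator $\omega$ of $\mathbb{F}_q^*$, and for integers $i,t\ge 0$ and $0\le j\le k-1$ let $$V_{i,j}=\Big\{\omega^i\varphi^j\begin{bmatrix}1&z\\0&y\end{bmatrix}: z\in\mathbb{F}_q,\ y\in\mathbb{F}_q^*\Big\},\qquad H_{t,j}=\Big\{\varphi^j\begin{bmatrix}x&z\\0&\omega^t\end{bmatrix}: x\in\mathbb{F}_q^*,\ z\in\mathbb{F}_q\Big\},$$ where $\omega^i$ stands for the scalar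 matrix; the first index only matters modulo $q-1$. Call a sequence $(r_0,\dots,r_{k-1})$ of non-negative integers admissible if * $r_0=0$; * $r_j\le \frac{q-1}{p^{\gcd(j,k)}-1}-1$ for $0\le j\le k-1$; * $r_j(p^j-1)\equiv r_{j'}(p^{j'}-1) \pmod{p^{j'-j}-1}$ for $0\le j<j'\le k-1$, as a congruence in $\mathbb{Z}/(q-1)\mathbb{Z}$; that is, the difference of the two sides is a multiple of $p^{j'-j}-1$ in the ring $\mathbb{Z}/(q-1)\mathbb{Z}$ (equivalently, the two integers are congruent modulo $\gcd(p^{j'-j}-1,q-1)=p^{\gcd(j'-j,k)}-1$). Then: 1. $\Gamma\mathrm{L}(2,q)$ acting on $\Omega$ has the EKR property: every intersecting set has size at most that of a point stabilizer. Each point stabilizer has size $kq(q-1)$, so every intersecting set has size at most $kq(q-1)$, and the maximum intersecting sets are exactly the intersecting sets of this size. 2. If $\mathcal F$ is a maximum intersecting set and $f\in\mathcal F$, then there is $g\in\Gamma\mathrm{L}(2,q)$ such that $g f^{-1}\mathcal F g^{-1}$ is of one of the following two types: * vertical type: $V_{0,0}\cup V_{r_1(p-1),1}\cup\dots\cup V_{r_j(p^j-1),j}\cup\dots\cup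 V_{r_{k-1}(p^{k-1}-1),k-1}$ with $(r_0,\dots,r_{k-1})$ admissible; * horizontal type: $H_{0,0}\cup H_{t_1(p-1),1}\cup\dots\cup H_{t_j(p^j-1),j}\cup\dots\cup H_{t_{k-1}(p^{k-1}-1),k-1}$ with $(t_0,\dots,t_{k-1})$ admissible. 3. Conversely, every set of vertical or horizontal type is a maximum intersecting set. -/

import Mathlib

noncomputable section

/-! ### Intersecting sets in a group acting on a set -/

section Intersecting

variable {G : Type*} [Group G] (Ω : Type*) [MulAction G Ω]

/-- A set of group elements is intersecting if any two of its elements agree on some point. -/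
def IsIntersecting (S : Set G) : Prop :=
  ∀ g ∈ S, ∀ h ∈ S, ∃ w : Ω, g • w = h • w

/-- An intersecting set of the largest possible size. -/
def IsMaximumIntersecting (S : Set G) : Prop :=
  IsIntersecting Ω S ∧ ∀ T : Set G, IsIntersecting Ω T → T.ncard ≤ S.ncard

variable (G) in
/-- The EKR property: no intersecting set is larger than a point stabilizer. -/
def HasEKR : Prop :=
  ∀ S : Set G, IsIntersecting Ω S → ∀ w : Ω, S.ncard ≤ Nat.card (MulAction.stabilizer G w)

end Intersecting

/-! ### The semilinear group `ΓL(2, F)` -/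

section Semilinear

open Matrix

/-- Ring automorphisms of `F` act on `GL(2, F)` entrywise. -/
def entrywise (F : Type*) [Field F] : RingAut F →* MulAut (GL (Fin 2) F) where
  toFun σ := Units.mapEquiv (RingEquiv.mapMatrix (m := Fin 2) σ).toMulEquiv
  map_one' := by ext; rfl
  map_mul' _ _ := by ext; rfl

variable (p : ℕ) [Fact p.Prime] (F : Type*) [Field F] [Fintype F] [CharP F p]

/-- The Frobenius automorphism `x ↦ x ^ p` of the finite field `F`. -/
def frob : RingAut F := frobeniusEquiv F p

/-- `ΓL(2, F) = GL(2, F) ⋊ ⟨φ⟩`, where `φ` is the Frobenius automorphism. -/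
abbrev GammaL : Type _ :=
  SemidirectProduct (GL (Fin 2) F) (Subgroup.zpowers (frob p F))
    ((entrywise F).comp (Subgroup.zpowers (frob p F)).subtype)

/-- The nonzero vectors of `F ^ 2`. -/
abbrev NonzeroVec : Type _ := {v : Fin 2 → F // v ≠ 0}

variable {p F}

theorem mulVec_comp_ne_zero (A : GL (Fin 2) F) (σ : RingAut F) {v : Fin 2 → F} (hv : v ≠ 0) :
    (A : Matrix (Fin 2) (Fin 2) F) *ᵥ (fun i => σ (v i)) ≠ 0 := by
  intro h
  apply hv
  have h2 := congrArg (fun w => ((A⁻¹ : GL (Fin 2) F) : Matrix (Fin 2) (Fin 2) F) *ᵥ w) h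
  simp only [mulVec_mulVec, ← Units.val_mul, inv_mul_cancel, Units.val_one, one_mulVec,
    mulVec_zero] at h2
  funext i
  have h3 := congrFun h2 i
  simpa using h3

/-- The element `A σ` acts on nonzero vectors by applying `σ` entrywise and then `A`. -/
instance : MulAction (GammaL p F) (NonzeroVec F) where
  smul g v := ⟨(g.left : Matrix (Fin 2) (Fin 2) F) *ᵥ (fun i => (g.right : RingAut F) (v.1 i)),
    mulVec_comp_ne_zero g.left g.right v.2⟩
  one_smul v := by
    apply Subtype.ext
    change ((1 : GL (Fin 2) F) : Matrix (Fin 2) (Fin 2) F) *ᵥ (fun i => (1 : RingAut F) (v.1 i))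
      = v.1
    simp
  mul_smul g h v := by
    apply Subtype.ext
    change ((g.left * entrywise F (g.right : RingAut F) h.left : GL (Fin 2) F) :
        Matrix (Fin 2) (Fin 2) F) *ᵥ
          (fun i => ((g.right : RingAut F) * (h.right : RingAut F)) (v.1 i)) =
      (g.left : Matrix (Fin 2) (Fin 2) F) *ᵥ (fun i => (g.right : RingAut F)
        (((h.left : Matrix (Fin 2) (Fin 2) F) *ᵥ fun i => (h.right : RingAut F) (v.1 i)) i))
    rw [Units.val_mul, ← mulVec_mulVec]
    congr 1
    funext i
    simp [mulVec, dotProduct, entrywise]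

/-- The upper triangular matrix with rows `(x, z)` and `(0, y)`. -/
def upperTri (x : Fˣ) (z : F) (y : Fˣ) : GL (Fin 2) F :=
  GeneralLinearGroup.mkOfDetNeZero !![(x : F), z; 0, (y : F)] (by simp [det_fin_two])

variable (p) in
/-- A matrix, as an element of `ΓL(2, F)`. -/
def ofGL (A : GL (Fin 2) F) : GammaL p F := SemidirectProduct.inl A

variable (p F) in
/-- The power `φ ^ j` of the Frobenius automorphism, as an element of `ΓL(2, F)`. -/
def frobPow (j : ℕ) : GammaL p F :=
  SemidirectProduct.inr ⟨frob p F ^ j, j, by simp⟩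

variable (p) in
/-- `V_{i,j}`: all `ω ^ i φ ^ j [1 z; 0 y]` with `z ∈ F` and `y ∈ Fˣ`.
It depends on `i` only modulo the order of `ω`. -/
def vSet (ω : Fˣ) (i j : ℕ) : Set (GammaL p F) :=
  {g | ∃ (z : F) (y : Fˣ),
    g = ofGL p (GeneralLinearGroup.scalar (Fin 2) (ω ^ i)) * frobPow p F j * ofGL p (upperTri 1 z y)}

variable (p) in
/-- `H_{t,j}`: all `φ ^ j [x z; 0 ω ^ t]` with `x ∈ Fˣ` and `z ∈ F`.
It depends on `t` only modulo the order of `ω`. -/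
def hSet (ω : Fˣ) (t j : ℕ) : Set (GammaL p F) :=
  {g | ∃ (x : Fˣ) (z : F), g = frobPow p F j * ofGL p (upperTri x z (ω ^ t))}

/-- The conditions on the parameters `r_0, …, r_{k-1}`, where `q = p ^ k`. The numbers
`r_j (p ^ j - 1)` are exponents of an element of order `q - 1`, so that they are residue
classes modulo `q - 1`, and their congruence modulo `p ^ (j' - j) - 1` is
divisibility of the difference by `p ^ (j' - j) - 1` in `ℤ/(q-1)ℤ`. -/
def Admissible (p k : ℕ) (r : ℕ → ℕ) : Prop :=
  r 0 = 0 ∧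
  (∀ j < k, r j ≤ (p ^ k - 1) / (p ^ Nat.gcd j k - 1) - 1) ∧
  ∀ j j', j < j' → j' < k →
    ((p : ZMod (p ^ k - 1)) ^ (j' - j) - 1) ∣
      ((r j : ZMod (p ^ k - 1)) * ((p : ZMod (p ^ k - 1)) ^ j - 1)
        - (r j' : ZMod (p ^ k - 1)) * ((p : ZMod (p ^ k - 1)) ^ j' - 1))

/-- `V_{0,0} ∪ V_{r_1(p-1),1} ∪ … ∪ V_{r_{k-1}(p^{k-1}-1),k-1}` with admissible `r`. -/
def IsVerticalType (k : ℕ) (ω : Fˣ) (S : Set (GammaL p F)) : Prop :=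
  ∃ r : ℕ → ℕ, Admissible p k r ∧ S = ⋃ j ∈ Finset.range k, vSet p ω (r j * (p ^ j - 1)) j

/-- `H_{0,0} ∪ H_{t_1(p-1),1} ∪ … ∪ H_{t_{k-1}(p^{k-1}-1),k-1}` with admissible `t`. -/
def IsHorizontalType (k : ℕ) (ω : Fˣ) (S : Set (GammaL p F)) : Prop :=
  ∃ t : ℕ → ℕ, Admissible p k t ∧ S = ⋃ j ∈ Finset.range k, hSet p ω (t j * (p ^ j - 1)) j

end Semilinear

end

/-! Sort an intersecting set `S` by the field automorphism `σ` of its elements `A σ`. Two elements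
over the same `σ` agree at a nonzero vector only if their matrices have singular difference, and a
family of invertible matrices with pairwise singular differences lies in a pencil: all of its
members take some column vector `u ≠ 0` to the same vector, or all of them take some row vector to
the same row vector. Indeed `A - B = c (perp u)ᵀ` for two members, and for a third one `N` the
determinant condition reads `perp c ⬝ᵥ (N - B) *ᵥ u = 0`, so that `N` agrees with `B` on the
column `u` or on the row `perp c`. A pencil has `q (q - 1)` elements, exactly as many as a point
stabilizer has over each `σ`; this is the EKR property, and it shows that `S` is maximum if and
only if all of its fibers are pencils.

The automorphism `A σ ↦ (det A)⁻¹ A σ` interchanges column pencils and row pencils and preserves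
agreement at a nonzero vector. So let `S ∋ 1` be maximum with the column pencil of `(1, 0)` over
`σ = 1`. A semilinear map `C σ` whose only fixed vector is `0` shows that `A` and `(A C) σ` never
agree; for odd `q` there are enough such `C`, by a pigeonhole argument on odd functions, to force
the fiber over every `σ` to be the column pencil taking `(1, 0)` to some `(a σ, 0)`. Such a family
of pencils is intersecting if and only if for all `σ`, `τ` the maps `a σ · σ` and `a τ · τ` agree
at some nonzero scalar. Comparing discrete logarithms turns this into the admissibility
congruences. -/

section Intersecting

open MulAction

variable {G Ω : Type*} [Group G] [MulAction G Ω] {S : Set G}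

theorem isIntersecting_stabilizer (w : Ω) : IsIntersecting Ω (stabilizer G w : Set G) :=
  fun _ hg _ hh => ⟨w, hg.trans hh.symm⟩

theorem IsIntersecting.image_mul_left (hS : IsIntersecting Ω S) (f : G) :
    IsIntersecting Ω ((f * ·) '' S) := by
  rintro _ ⟨s, hs, rfl⟩ _ ⟨t, ht, rfl⟩
  obtain ⟨w, hw⟩ := hS s hs t ht
  exact ⟨w, by simp only [mul_smul, hw]⟩

theorem IsIntersecting.image_conj (hS : IsIntersecting Ω S) (f : G) :
    IsIntersecting Ω (MulAut.conj f '' S) := by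
  rintro _ ⟨s, hs, rfl⟩ _ ⟨t, ht, rfl⟩
  obtain ⟨w, hw⟩ := hS s hs t ht
  exact ⟨f • w, by simp only [MulAut.conj_apply, mul_smul, inv_smul_smul, hw]⟩

theorem IsMaximumIntersecting.image_of_injective (hS : IsMaximumIntersecting Ω S) {f : G → G}
    (hf : Function.Injective f) (hfS : IsIntersecting Ω (f '' S)) :
    IsMaximumIntersecting Ω (f '' S) :=
  ⟨hfS, fun T hT => by
    rw [Set.ncard_image_of_injective S hf]
    exact hS.2 T hT⟩

theorem HasEKR.isMaximumIntersecting_iff (h : HasEKR G Ω) (w : Ω) :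
    IsMaximumIntersecting Ω S ↔
      IsIntersecting Ω S ∧ S.ncard = Nat.card (stabilizer G w) := by
  refine and_congr_right fun hS => ⟨fun hmax => ?_, fun hcard T hT => hcard ▸ h T hT w⟩
  exact (h S hS w).antisymm (hmax _ (isIntersecting_stabilizer w))

end Intersecting

section FiniteField

variable {F : Type*} [Field F] [Finite F]

theorem exists_unit_forall_eq_zero_of_mul_eq (h2 : (2 : F) ≠ 0) {L M : F → F}
    (hL : L.Odd) (hM : M.Odd) (hM0 : ∀ y, M y = 0 → y = 0) :
    ∃ c : Fˣ, ∀ y, c * L y = M y → y = 0 := by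
  by_contra! h
  choose y hy hy0 using h
  have hLy : ∀ c, L (y c) ≠ 0 := fun c hc => hy0 c (hM0 _ (by rw [← hy, hc, mul_zero]))
  have hinj : Function.Injective fun c => Units.mk0 (y c) (hy0 c) := by
    intro c d hcd
    have hyd : y c = y d := congrArg Units.val hcd
    refine Units.ext (mul_right_cancel₀ (hLy c) ?_)
    rw [hy c, hyd, hy d]
  -- `y` is a permutation of `Fˣ`, but `-y 1` could only be attained at `1`.
  obtain ⟨c, hc⟩ := Finite.surjective_of_injective hinj (-Units.mk0 (y 1) (hy0 1))
  have hyc : y c = -y 1 := congrArg Units.val hc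
  have hc1 : c = 1 := by
    refine Units.ext (mul_right_cancel₀ (hLy 1) ?_)
    have := hy c
    rw [hyc, hL, hM, mul_neg, neg_inj] at this
    rw [this, hy 1]
  rw [hc1, eq_neg_iff_add_eq_zero, ← two_mul] at hyc
  exact (mul_eq_zero.mp hyc).elim h2 (hy0 1)

end FiniteField

section Plane

open Matrix

theorem vec2_eq_iff {α : Type*} {u w : Fin 2 → α} : u = w ↔ u 0 = w 0 ∧ u 1 = w 1 :=
  funext_iff.trans Fin.forall_fin_two

/-- The vector `u` turned by a quarter of a circle, so that `perp u ⬝ᵥ v` is up to sign the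
determinant of the pair `(u, v)`. -/
def perp {R : Type*} [Neg R] (u : Fin 2 → R) : Fin 2 → R := ![u 1, -u 0]

section CommRing

variable {R : Type*} [CommRing R]

theorem mulVec_vec2 (a b c d : R) (v : Fin 2 → R) :
    !![a, b; c, d] *ᵥ v = ![a * v 0 + b * v 1, c * v 0 + d * v 1] :=
  mulVec_fin_two _ v

theorem vecMul_vec2 (a b c d : R) (v : Fin 2 → R) :
    v ᵥ* !![a, b; c, d] = ![v 0 * a + v 1 * c, v 0 * b + v 1 * d] :=
  vec2_eq_iff.mpr ⟨vec2_dotProduct v _, vec2_dotProduct v _⟩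

theorem perp_perp (u : Fin 2 → R) : perp (perp u) = -u :=
  vec2_eq_iff.mpr ⟨rfl, rfl⟩

theorem perp_injective : Function.Injective (perp (R := R)) := fun u v h => by
  rw [← neg_inj, ← perp_perp, h, perp_perp]

theorem perp_ne_zero {u : Fin 2 → R} (hu : u ≠ 0) : perp u ≠ 0 := fun h => by
  have h0 := perp_perp u
  rw [h, eq_comm, neg_eq_iff_eq_neg] at h0
  exact hu (h0.trans (vec2_eq_iff.mpr (by simp [perp])))

theorem perp_smul (c : R) (u : Fin 2 → R) : perp (c • u) = c • perp u :=
  vec2_eq_iff.mpr ⟨rfl, (mul_neg c (u 0)).symm⟩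

theorem perp_mulVec_dotProduct_mulVec (A : Matrix (Fin 2) (Fin 2) R) (u v : Fin 2 → R) :
    perp (A *ᵥ u) ⬝ᵥ (A *ᵥ v) = A.det * (perp u ⬝ᵥ v) := by
  simp only [perp, mulVec_fin_two, det_fin_two, vec2_dotProduct, cons_val_zero, cons_val_one]
  ring

theorem mulVec_perp_vecMul (A : Matrix (Fin 2) (Fin 2) R) (x : Fin 2 → R) :
    A *ᵥ perp (x ᵥ* A) = A.det • perp x := by
  rw [eta_fin_two A, vecMul_vec2, mulVec_vec2, det_fin_two_of, vec2_eq_iff]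
  constructor <;> simp only [perp, cons_val_zero, cons_val_one, Pi.smul_apply, smul_eq_mul] <;> ring

theorem det_sub_vecMulVec_perp (D : Matrix (Fin 2) (Fin 2) R) (c u : Fin 2 → R) :
    (D - vecMulVec c (perp u)).det = D.det + perp c ⬝ᵥ (D *ᵥ u) := by
  simp only [perp, det_fin_two, Matrix.sub_apply, vecMulVec_apply, mulVec_fin_two,
    vec2_dotProduct, cons_val_zero, cons_val_one]
  ring

end CommRing

variable {F : Type*} [Field F]

theorem exists_eq_smul_perp {w x : Fin 2 → F} (hw : w ≠ 0) (h : x ⬝ᵥ w = 0) :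
    ∃ c : F, x = c • perp w := by
  rw [vec2_dotProduct] at h
  by_cases h0 : w 0 = 0
  · have h1 : w 1 ≠ 0 := fun h1 => hw (vec2_eq_iff.mpr ⟨h0, h1⟩)
    have hx1 : x 1 = 0 := by simpa [h0, h1] using h
    exact ⟨x 0 / w 1, vec2_eq_iff.mpr ⟨by simp [perp, h1], by simp [perp, h0, hx1]⟩⟩
  · have hx0 : x 0 = -x 1 / w 0 * w 1 := by
      field_simp
      linear_combination h
    exact ⟨-x 1 / w 0, vec2_eq_iff.mpr ⟨hx0, by simp [perp, h0]⟩⟩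

theorem mulVec_eq_zero_or_vecMul_eq_zero {D : Matrix (Fin 2) (Fin 2) F} (hD : D.det = 0)
    {x u : Fin 2 → F} (h : x ⬝ᵥ (D *ᵥ u) = 0) : D *ᵥ u = 0 ∨ x ᵥ* D = 0 := by
  refine or_iff_not_imp_left.mpr fun hu => ?_
  obtain ⟨c, rfl⟩ := exists_eq_smul_perp hu h
  refine dotProduct_eq_zero _ fun v => ?_
  rw [← dotProduct_mulVec, smul_dotProduct, perp_mulVec_dotProduct_mulVec, hD, zero_mul,
    smul_zero]

theorem exists_eq_vecMulVec_perp {M : Matrix (Fin 2) (Fin 2) F} (hM : M.det = 0) :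
    ∃ c u : Fin 2 → F, u ≠ 0 ∧ M = vecMulVec c (perp u) := by
  obtain ⟨u, hu, hMu⟩ := exists_mulVec_eq_zero_iff.mpr hM
  choose c hc using fun i => exists_eq_smul_perp (x := M i) hu (congrFun hMu i)
  exact ⟨c, u, hu, by ext i j; rw [hc i]; rfl⟩

end Plane

section Pencils

open Matrix

variable {F : Type*} [Field F]

/-- The invertible matrices that take the column vector `u` to `w`. -/
def transporter (u w : Fin 2 → F) : Set (GL (Fin 2) F) := {A | A.1 *ᵥ u = w}

/-- The invertible matrices that take the row vector `x` to `y`. -/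
def cotransporter (x y : Fin 2 → F) : Set (GL (Fin 2) F) := {A | x ᵥ* A.1 = y}

/-- Maximal families of invertible matrices any two of which differ by a singular matrix: the
cosets of the stabilizers of nonzero column vectors and of nonzero row vectors. -/
def IsPencil (T : Set (GL (Fin 2) F)) : Prop :=
  ∃ u w, u ≠ 0 ∧ w ≠ 0 ∧ (T = transporter u w ∨ T = cotransporter u w)

/-- The involution `A ↦ (det A)⁻¹ A` of `GL(2, F)`. It is the inverse transpose followed by a
conjugation, and so it interchanges the two kinds of pencils. -/
def detTwist : GL (Fin 2) F →* GL (Fin 2) F where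
  toFun A := GeneralLinearGroup.scalar (Fin 2) (GeneralLinearGroup.det A)⁻¹ * A
  map_one' := by simp only [map_one, inv_one, mul_one]
  map_mul' A B := by
    rw [map_mul, mul_inv, map_mul, mul_assoc, ← mul_assoc _ A B,
      GeneralLinearGroup.scalar_commute _ A, mul_assoc, mul_assoc]

theorem coe_detTwist (A : GL (Fin 2) F) : (detTwist A).1 = A.1.det⁻¹ • A.1 := by
  rw [smul_eq_diagonal_mul, ← GeneralLinearGroup.val_det_apply, ← Units.val_inv_eq_inv_val]
  rfl

theorem det_coe_detTwist (A : GL (Fin 2) F) : (detTwist A).1.det = A.1.det⁻¹ := by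
  have := GeneralLinearGroup.det_ne_zero A
  rw [coe_detTwist, det_smul, Fintype.card_fin]
  field_simp

theorem detTwist_involutive : Function.Involutive (detTwist (F := F)) := fun A => by
  ext i j
  rw [coe_detTwist, det_coe_detTwist, coe_detTwist, inv_inv, smul_smul,
    mul_inv_cancel₀ (GeneralLinearGroup.det_ne_zero A), one_smul]

theorem mulVec_GL_injective (A : GL (Fin 2) F) : Function.Injective A.1.mulVec :=
  mulVec_injective_of_isUnit A.isUnit

theorem mulVec_GL_ne_zero (A : GL (Fin 2) F) {u : Fin 2 → F} (hu : u ≠ 0) : A.1 *ᵥ u ≠ 0 :=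
  fun h => hu (mulVec_GL_injective A (h.trans (mulVec_zero _).symm))

theorem cotransporter_eq_preimage_detTwist (x y : Fin 2 → F) :
    cotransporter x y = detTwist ⁻¹' transporter (perp y) (perp x) := by
  ext A
  have hA := GeneralLinearGroup.det_ne_zero A
  calc x ᵥ* A.1 = y ↔ A.1 *ᵥ perp (x ᵥ* A.1) = A.1 *ᵥ perp y :=
        ((mulVec_GL_injective A).comp perp_injective).eq_iff.symm
    _ ↔ A.1.det⁻¹ • A.1 *ᵥ perp y = perp x := by
        rw [mulVec_perp_vecMul, inv_smul_eq_iff₀ hA, eq_comm]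
    _ ↔ detTwist A ∈ transporter (perp y) (perp x) := by
        rw [transporter, Set.mem_ofPred_eq, coe_detTwist, smul_mulVec]

theorem image_mul_mul_inv_transporter (g h : GL (Fin 2) F) (u w : Fin 2 → F) :
    (fun A => h * A * g⁻¹) '' transporter u w = transporter (g.1 *ᵥ u) (h.1 *ᵥ w) := by
  refine Set.Subset.antisymm ?_ fun B hB => ⟨h⁻¹ * B * g, ?_, by group⟩
  · rintro _ ⟨A, rfl : A.1 *ᵥ u = w, rfl⟩
    rw [transporter, Set.mem_ofPred_eq, mulVec_mulVec, mulVec_mulVec, ← Units.val_mul,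
      ← Units.val_mul, inv_mul_cancel_right]
  · have hB' : B.1 *ᵥ (g.1 *ᵥ u) = h.1 *ᵥ w := hB
    refine mulVec_GL_injective h ?_
    simp only [Units.val_mul, ← mulVec_mulVec, hB']
    simp only [mulVec_mulVec, ← Units.val_mul, mul_inv_cancel_left]

theorem exists_mulVec_eq {u : Fin 2 → F} (hu : u ≠ 0) :
    ∃ A : GL (Fin 2) F, A.1 *ᵥ ![1, 0] = u := by
  by_cases h0 : u 0 = 0
  · have h1 : u 1 ≠ 0 := fun h1 => hu (vec2_eq_iff.mpr ⟨h0, h1⟩)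
    refine ⟨GeneralLinearGroup.mkOfDetNeZero !![0, 1; u 1, 0] (by simpa [det_fin_two]), ?_⟩
    simp [GeneralLinearGroup.mkOfDetNeZero, vec2_eq_iff, h0]
  · refine ⟨GeneralLinearGroup.mkOfDetNeZero !![u 0, 0; u 1, 1] (by simpa [det_fin_two]), ?_⟩
    simp [GeneralLinearGroup.mkOfDetNeZero, vec2_eq_iff]

theorem coe_upperTri (x : Fˣ) (z : F) (y : Fˣ) : (upperTri x z y).1 = !![(x : F), z; 0, (y : F)] :=
  rfl

theorem exists_eq_upperTri {A : GL (Fin 2) F} (hA : A.1 1 0 = 0) :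
    ∃ x z y, A = upperTri x z y := by
  have hdet := GeneralLinearGroup.det_ne_zero A
  rw [det_fin_two, hA, mul_zero, sub_zero, mul_ne_zero_iff] at hdet
  refine ⟨Units.mk0 _ hdet.1, A.1 0 1, Units.mk0 _ hdet.2, Units.ext ?_⟩
  rw [coe_upperTri, Units.val_mk0, Units.val_mk0, ← hA, ← eta_fin_two]

theorem transporter_first_eq_range :
    transporter ![1, 0] ![1, 0] = Set.range fun zy : F × Fˣ => upperTri 1 zy.1 zy.2 := by
  ext A
  constructor
  · intro hA
    have hA0 : A.1 0 0 = 1 := by simpa [mulVec_fin_two] using congrFun hA 0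
    obtain ⟨x, z, y, rfl⟩ :=
      exists_eq_upperTri (A := A) (by simpa [mulVec_fin_two] using congrFun hA 1)
    obtain rfl : x = 1 := Units.ext hA0
    exact ⟨(z, y), rfl⟩
  · rintro ⟨⟨z, y⟩, rfl⟩
    simp [transporter, coe_upperTri]

theorem ncard_transporter {u w : Fin 2 → F} (hu : u ≠ 0) (hw : w ≠ 0) :
    (transporter u w).ncard = Nat.card F * (Nat.card F - 1) := by
  obtain ⟨g, rfl⟩ := exists_mulVec_eq hu
  obtain ⟨h, rfl⟩ := exists_mulVec_eq hw
  have hinj : Function.Injective fun A : GL (Fin 2) F => h * A * g⁻¹ := fun A B hAB =>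
    mul_left_cancel (mul_right_cancel hAB)
  have hinj' : Function.Injective fun zy : F × Fˣ => upperTri 1 zy.1 zy.2 := fun a b hab => by
    have hval := congrArg Units.val hab
    simp only [coe_upperTri] at hval
    exact Prod.ext (congrFun₂ hval 0 1) (Units.ext (congrFun₂ hval 1 1))
  rw [← image_mul_mul_inv_transporter, Set.ncard_image_of_injective _ hinj,
    transporter_first_eq_range, ← Set.image_univ, Set.ncard_image_of_injective _ hinj',
    Set.ncard_univ, Nat.card_prod, Nat.card_units]

theorem IsPencil.ncard {T : Set (GL (Fin 2) F)} (hT : IsPencil T) :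
    T.ncard = Nat.card F * (Nat.card F - 1) := by
  obtain ⟨u, w, hu, hw, rfl | rfl⟩ := hT
  · exact ncard_transporter hu hw
  · rw [cotransporter_eq_preimage_detTwist, ← detTwist_involutive.image_eq_preimage_symm,
      Set.ncard_image_of_injective _ detTwist_involutive.injective,
      ncard_transporter (perp_ne_zero hw) (perp_ne_zero hu)]

end Pencils

section Cliques

open Matrix

variable {F : Type*} [Field F]

theorem exists_isPencil_superset {S : Set (GL (Fin 2) F)}
    (hS : ∀ A ∈ S, ∀ B ∈ S, (A.1 - B.1).det = 0) : ∃ T, IsPencil T ∧ S ⊆ T := by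
  by_cases hsub : S.Subsingleton
  · have h1 : (![1, 0] : Fin 2 → F) ≠ 0 := by simp
    obtain rfl | ⟨A, rfl⟩ := hsub.eq_empty_or_singleton
    · exact ⟨_, ⟨_, _, h1, h1, .inl rfl⟩, Set.empty_subset _⟩
    · exact ⟨_, ⟨_, _, h1, mulVec_GL_ne_zero A h1, .inl rfl⟩, Set.singleton_subset_iff.mpr rfl⟩
  obtain ⟨B, hB, A, hA, hBA⟩ := Set.not_subsingleton_iff.mp hsub
  obtain ⟨c, u, hu, hM⟩ := exists_eq_vecMulVec_perp (hS A hA B hB)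
  have hc : perp c ≠ 0 := perp_ne_zero <| by
    rintro rfl
    exact hBA (Units.ext (sub_eq_zero.mp (hM.trans (zero_vecMulVec _))).symm)
  have hcu : ∀ N ∈ S, perp c ⬝ᵥ (N.1 - B.1) *ᵥ u = 0 := fun N hN => by
    have h := det_sub_vecMulVec_perp (N.1 - B.1) c u
    rwa [← hM, sub_sub_sub_cancel_right, hS N hN A hA, hS N hN B hB, zero_add, eq_comm] at h
  have hor : ∀ N ∈ S, ∀ N' ∈ S,
      N.1 *ᵥ u = N'.1 *ᵥ u ∨ perp c ᵥ* N.1 = perp c ᵥ* N'.1 := fun N hN N' hN' => by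
    rw [← sub_eq_zero, ← sub_mulVec, ← sub_eq_zero (a := _ ᵥ* _), ← vecMul_sub]
    refine mulVec_eq_zero_or_vecMul_eq_zero (hS N hN N' hN') ?_
    rw [← sub_sub_sub_cancel_right _ _ B.1, sub_mulVec, dotProduct_sub, hcu N hN, hcu N' hN',
      sub_zero]
  by_cases hV : ∀ N ∈ S, N.1 *ᵥ u = B.1 *ᵥ u
  · exact ⟨_, ⟨u, _, hu, mulVec_GL_ne_zero B hu, .inl rfl⟩, hV⟩
  push Not at hV
  obtain ⟨N, hN, hNB⟩ := hV
  refine ⟨cotransporter (perp c) (perp c ᵥ* B.1), ⟨_, _, hc, ?_, .inr rfl⟩, fun N' hN' => ?_⟩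
  · exact fun h => hc (vecMul_injective_of_isUnit B.isUnit (h.trans (zero_vecMul _).symm))
  · have hxN := (hor N hN B hB).resolve_left hNB
    by_contra hxN'
    have huN' := (hor N' hN' B hB).resolve_right hxN'
    obtain h | h := hor N hN N' hN'
    · exact hNB (h.trans huN')
    · exact hxN' (h.symm.trans hxN)

end Cliques

section Agreement

open Matrix

variable {F : Type*} [Field F] {σ τ : RingAut F} {A B : GL (Fin 2) F}

/-- The semilinear maps `A σ` and `B τ` of the plane agree at some nonzero vector. -/
def Agree (σ τ : RingAut F) (A B : GL (Fin 2) F) : Prop :=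
  ∃ v ≠ 0, A.1 *ᵥ (σ ∘ v) = B.1 *ᵥ (τ ∘ v)

theorem ringAut_comp_ne_zero (σ : RingAut F) {v : Fin 2 → F} (hv : v ≠ 0) : σ ∘ v ≠ 0 := fun h =>
  hv (funext fun i => (map_eq_zero σ).mp (congrFun h i))

theorem Agree.det_sub_eq_zero (h : Agree σ σ A B) : (A.1 - B.1).det = 0 := by
  obtain ⟨v, hv, hAB⟩ := h
  exact exists_mulVec_eq_zero_iff.mp
    ⟨σ ∘ v, ringAut_comp_ne_zero σ hv, by rw [sub_mulVec, hAB, sub_self]⟩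

theorem ringAut_perp_dotProduct (σ : RingAut F) (u v : Fin 2 → F) :
    perp (σ ∘ u) ⬝ᵥ (σ ∘ v) = σ (perp u ⬝ᵥ v) := by
  simp only [perp, vec2_dotProduct, cons_val_zero, cons_val_one, Function.comp_apply, map_add,
    map_mul, map_neg]

theorem perp_detTwist_mulVec_dotProduct (A : GL (Fin 2) F) (u v : Fin 2 → F) :
    perp ((detTwist A).1 *ᵥ u) ⬝ᵥ (A.1 *ᵥ v) = perp u ⬝ᵥ v := by
  rw [coe_detTwist, smul_mulVec, perp_smul, smul_dotProduct, perp_mulVec_dotProduct_mulVec,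
    smul_eq_mul, inv_mul_cancel_left₀ (GeneralLinearGroup.det_ne_zero A)]

theorem Agree.of_detTwist [Finite F] (h : Agree σ τ (detTwist A) (detTwist B)) :
    Agree σ τ A B := by
  obtain ⟨w, hw, hm⟩ := h
  by_contra hAB
  -- Otherwise `A σ - B τ` is onto, and pairing it with `m` makes `σ - τ` onto, but this kills `1`.
  let f : (Fin 2 → F) →+ (Fin 2 → F) :=
    AddMonoidHom.mk' (fun v => A.1 *ᵥ (σ ∘ v) - B.1 *ᵥ (τ ∘ v)) fun u v => by
      have hadd : ∀ ρ : RingAut F, ρ ∘ (u + v) = ρ ∘ u + ρ ∘ v := fun ρ =>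
        funext fun i => map_add ρ _ _
      rw [hadd, hadd, mulVec_add, mulVec_add, add_sub_add_comm]
  have hf : Function.Surjective f := by
    refine Finite.surjective_of_injective ((injective_iff_map_eq_zero f).mpr fun v hv => ?_)
    by_contra hv0
    exact hAB ⟨v, hv0, sub_eq_zero.mp hv⟩
  set m := (detTwist A).1 *ᵥ (σ ∘ w)
  have hmf : ∀ v, perp m ⬝ᵥ f v = σ (perp w ⬝ᵥ v) - τ (perp w ⬝ᵥ v) := fun v => by
    have hA := perp_detTwist_mulVec_dotProduct A (σ ∘ w) (σ ∘ v)
    have hB := perp_detTwist_mulVec_dotProduct B (τ ∘ w) (τ ∘ v)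
    rw [ringAut_perp_dotProduct] at hA hB
    rw [← hm] at hB
    rw [← hA, ← hB, ← dotProduct_sub]
    rfl
  have hm0 : perp m ≠ 0 := perp_ne_zero (mulVec_GL_ne_zero _ (ringAut_comp_ne_zero σ hw))
  have hsurj : Function.Surjective fun x : F => σ x - τ x := fun t => by
    obtain ⟨i, hi⟩ := Function.ne_iff.mp hm0
    obtain ⟨v, hv⟩ := hf (Pi.single i (t / perp m i))
    refine ⟨perp w ⬝ᵥ v, ?_⟩
    simp only [← hmf, hv, dotProduct_single]
    exact mul_div_cancel₀ t hi
  exact one_ne_zero (Finite.injective_iff_surjective.mpr hsurj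
    (show σ 1 - τ 1 = σ 0 - τ 0 by simp only [map_one, map_zero, sub_self]))

end Agreement

section FixesOnlyZero

open Matrix

variable {F : Type*} [Field F] {σ : RingAut F}

/-- The semilinear map `C σ` of the plane has no nonzero fixed vector. -/
def FixesOnlyZero (σ : RingAut F) (C : Matrix (Fin 2) (Fin 2) F) : Prop :=
  ∀ v, C *ᵥ (σ ∘ v) = v → v = 0

theorem FixesOnlyZero.not_agree_mul {C : Matrix (Fin 2) (Fin 2) F} (hC : FixesOnlyZero σ C)
    (hdet : C.det ≠ 0) (A : GL (Fin 2) F) :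
    ¬Agree 1 σ A (A * GeneralLinearGroup.mkOfDetNeZero C hdet) := by
  rintro ⟨v, hv, h⟩
  rw [Units.val_mul, ← mulVec_mulVec] at h
  exact hv (hC v (mulVec_GL_injective A h).symm)

theorem exists_fixesOnlyZero_lower [Finite F] (h2 : (2 : F) ≠ 0) (σ : RingAut F) :
    ∃ a : Fˣ, ∀ c, FixesOnlyZero σ !![(a : F), 0; c, a] := by
  obtain ⟨a, ha⟩ := exists_unit_forall_eq_zero_of_mul_eq h2 (L := σ) (M := id) (map_neg σ)
    (fun _ => rfl) fun _ => id
  refine ⟨a, fun c v hv => ?_⟩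
  rw [mulVec_vec2, vec2_eq_iff] at hv
  have hv0 : v 0 = 0 := ha _ (by simpa using hv.1)
  have hv1 : v 1 = 0 := ha _ (by simpa [hv0] using hv.2)
  exact vec2_eq_iff.mpr ⟨hv0, hv1⟩

theorem exists_fixesOnlyZero_antidiagonal [Finite F] (h2 : (2 : F) ≠ 0) (σ : RingAut F)
    (b ε : F) : ∃ c : Fˣ, FixesOnlyZero σ !![0, b; c, c * ε] := by
  obtain ⟨c, hc⟩ := exists_unit_forall_eq_zero_of_mul_eq h2
    (L := fun y => σ (b * σ y) + ε * σ y) (M := id)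
    (fun y => by simp only [map_neg, mul_neg, neg_add]) (fun _ => rfl) fun _ => id
  refine ⟨c, fun v hv => ?_⟩
  rw [mulVec_vec2, vec2_eq_iff] at hv
  have hv0 : b * σ (v 1) = v 0 := by simpa using hv.1
  have hv1 : v 1 = 0 := hc _ (by simpa [hv0, mul_add, mul_assoc] using hv.2)
  exact vec2_eq_iff.mpr ⟨by simpa [hv1] using hv0.symm, hv1⟩

end FixesOnlyZero

section PencilAgreement

open Matrix

variable {F : Type*} [Field F] {σ : RingAut F} {u w x y : Fin 2 → F}

theorem upperTri_one_mem_transporter (z : F) (y : Fˣ) :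
    upperTri 1 z y ∈ transporter (![1, 0] : Fin 2 → F) ![1, 0] := by
  rw [transporter_first_eq_range]
  exact Set.mem_range_self (z, y)

theorem exists_mem_transporter_mulVec_eq (hu : u 1 ≠ 0) (hw : w 1 ≠ 0) :
    ∃ A ∈ transporter (![1, 0] : Fin 2 → F) ![1, 0], A.1 *ᵥ u = w := by
  refine ⟨_, upperTri_one_mem_transporter ((w 0 - u 0) / u 1)
    (Units.mk0 (w 1 / u 1) (div_ne_zero hw hu)), ?_⟩
  rw [coe_upperTri, mulVec_vec2, vec2_eq_iff]
  simp [hu]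

theorem exists_mem_transporter_vecMul_eq (hx : x ≠ 0) (hy : y ≠ 0) (hxy : x 0 = y 0) :
    ∃ A ∈ transporter (![1, 0] : Fin 2 → F) ![1, 0], x ᵥ* A.1 = y := by
  by_cases h0 : x 0 = 0
  · have hx1 : x 1 ≠ 0 := fun h1 => hx (vec2_eq_iff.mpr ⟨h0, h1⟩)
    have hy1 : y 1 ≠ 0 := fun h1 => hy (vec2_eq_iff.mpr ⟨hxy ▸ h0, h1⟩)
    refine ⟨_, upperTri_one_mem_transporter 0 (Units.mk0 (y 1 / x 1) (div_ne_zero hy1 hx1)), ?_⟩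
    rw [coe_upperTri, vecMul_vec2, vec2_eq_iff]
    simp [hxy, mul_div_cancel₀ _ hx1]
  · refine ⟨_, upperTri_one_mem_transporter ((y 1 - x 1) / x 0) 1, ?_⟩
    rw [coe_upperTri, vecMul_vec2, vec2_eq_iff]
    simp [← hxy, mul_div_cancel₀ _ h0]

theorem apply_one_eq_zero_of_agree_transporter [Finite F] (h2 : (2 : F) ≠ 0)
    (hu : u ≠ 0) (hw : w ≠ 0)
    (h : ∀ A ∈ transporter ![1, 0] ![1, 0], ∀ B ∈ transporter u w, Agree 1 σ A B) :
    u 1 = 0 ∧ w 1 = 0 := by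
  have hne : ∀ C, FixesOnlyZero σ C → C.det ≠ 0 →
      ∀ A ∈ transporter ![1, 0] ![1, 0], A.1 *ᵥ (C *ᵥ u) ≠ w := fun C hC hdet A hA hw =>
    hC.not_agree_mul hdet A (h A hA _ ((mulVec_mulVec _ _ _).symm.trans hw))
  have hw1 : w 1 = 0 := by
    by_contra hw1
    obtain ⟨a, ha⟩ := exists_fixesOnlyZero_lower h2 σ
    have hc : ∃ c, c * u 0 + a * u 1 ≠ 0 := by
      by_contra! hc
      have h1 : u 1 = 0 := by simpa using hc 0
      have h0 : u 0 = 0 := by simpa [h1] using hc 1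
      exact hu (vec2_eq_iff.mpr ⟨h0, h1⟩)
    obtain ⟨c, hc⟩ := hc
    obtain ⟨A, hA, hAw⟩ := exists_mem_transporter_mulVec_eq
      (u := !![(a : F), 0; c, a] *ᵥ u) (by rwa [mulVec_vec2]) hw1
    exact hne _ (ha c) (by simp [det_fin_two]) A hA hAw
  have hw0 : w 0 ≠ 0 := fun h0 => hw (vec2_eq_iff.mpr ⟨h0, hw1⟩)
  refine ⟨by_contra fun hu1 => ?_, hw1⟩
  obtain ⟨c, hc⟩ := exists_fixesOnlyZero_antidiagonal h2 σ (w 0 / u 1) (-u 0 / u 1)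
  refine hne _ hc (by simp [det_fin_two, hw0, hu1]) 1 (by simp [transporter]) ?_
  have hw1' : c * u 0 + c * (-u 0 / u 1) * u 1 = w 1 := by
    rw [hw1]
    field_simp
    ring
  rw [Units.val_one, one_mulVec, mulVec_vec2, vec2_eq_iff]
  exact ⟨by simp [hu1], hw1'⟩

theorem exists_not_agree_cotransporter [Finite F] (h2 : (2 : F) ≠ 0) (hx : x ≠ 0) (hy : y ≠ 0)
    (σ : RingAut F) :
    ∃ A ∈ transporter ![1, 0] ![1, 0], ∃ B ∈ cotransporter x y, ¬Agree 1 σ A B := by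
  have key : ∀ C t, FixesOnlyZero σ C → C.det ≠ 0 → x 0 = t 0 → t ᵥ* C = y →
      ∃ A ∈ transporter ![1, 0] ![1, 0], ∃ B ∈ cotransporter x y, ¬Agree 1 σ A B := by
    rintro C t hC hdet hxt rfl
    have ht : t ≠ 0 := by
      rintro rfl
      exact hy (zero_vecMul C)
    obtain ⟨A, hA, rfl⟩ := exists_mem_transporter_vecMul_eq hx ht hxt
    exact ⟨A, hA, _, (vecMul_vecMul x A.1 C).symm, hC.not_agree_mul hdet A⟩
  by_cases hy1 : y 1 = 0
  · have hy0 : y 0 ≠ 0 := fun h0 => hy (vec2_eq_iff.mpr ⟨h0, hy1⟩)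
    obtain ⟨c, hc⟩ := exists_fixesOnlyZero_antidiagonal h2 σ 1 (-x 0 / y 0)
    have hy1' : x 0 * 1 + y 0 / c * (c * (-x 0 / y 0)) = y 1 := by
      rw [hy1]
      field_simp
      ring
    refine key _ ![x 0, y 0 / c] hc (by simp [det_fin_two]) rfl ?_
    rw [vecMul_vec2, vec2_eq_iff]
    exact ⟨by simp, hy1'⟩
  · obtain ⟨a, ha⟩ := exists_fixesOnlyZero_lower h2 σ
    have hy0 : x 0 * a + y 1 / a * ((y 0 - x 0 * a) / (y 1 / a)) = y 0 := by
      field_simp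
      ring
    refine key _ ![x 0, y 1 / a] (ha ((y 0 - x 0 * a) / (y 1 / a))) (by simp [det_fin_two]) rfl ?_
    rw [vecMul_vec2, vec2_eq_iff]
    exact ⟨hy0, by simp⟩

theorem IsPencil.exists_eq_transporter_of_agree [Finite F] (h2 : (2 : F) ≠ 0)
    {T : Set (GL (Fin 2) F)} (hT : IsPencil T)
    (h : ∀ A ∈ transporter ![1, 0] ![1, 0], ∀ B ∈ T, Agree 1 σ A B) :
    ∃ a : Fˣ, T = transporter ![1, 0] ![(a : F), 0] := by
  obtain ⟨u, w, hu, hw, rfl | rfl⟩ := hT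
  · obtain ⟨hu1, hw1⟩ := apply_one_eq_zero_of_agree_transporter h2 hu hw h
    have hu0 : u 0 ≠ 0 := fun h0 => hu (vec2_eq_iff.mpr ⟨h0, hu1⟩)
    have hw0 : w 0 ≠ 0 := fun h0 => hw (vec2_eq_iff.mpr ⟨h0, hw1⟩)
    have hu' : u = u 0 • ![1, 0] := vec2_eq_iff.mpr (by simp [hu1])
    have hw' : w = u 0 • ![w 0 / u 0, 0] :=
      vec2_eq_iff.mpr (by simp [hw1, mul_div_cancel₀ _ hu0])
    refine ⟨Units.mk0 (w 0 / u 0) (div_ne_zero hw0 hu0), Set.ext fun A => ?_⟩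
    calc A.1 *ᵥ u = w ↔ u 0 • A.1 *ᵥ ![1, 0] = u 0 • ![w 0 / u 0, 0] := by
          rw [← mulVec_smul, ← hu', ← hw']
      _ ↔ A.1 *ᵥ ![1, 0] = ![w 0 / u 0, 0] := (smul_right_injective _ hu0).eq_iff
  · obtain ⟨A, hA, B, hB, hAB⟩ := exists_not_agree_cotransporter h2 hu hw σ
    exact (hAB (h A hA B hB)).elim

end PencilAgreement

section SemilinearGroup

open Matrix

variable {p : ℕ} [Fact p.Prime] {F : Type*} [Field F] [Fintype F] [CharP F p]

variable (p F) in
/-- The group `⟨φ⟩` of field automorphisms occurring in `ΓL(2, F)`. -/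
noncomputable abbrev FrobGroup : Subgroup (RingAut F) := Subgroup.zpowers (frob p F)

/-- The matrices `A` with `A σ` in `S`. -/
def fiber (S : Set (GammaL p F)) (σ : FrobGroup p F) : Set (GL (Fin 2) F) := {A | ⟨A, σ⟩ ∈ S}

variable {S : Set (GammaL p F)}

theorem isIntersecting_iff_agree :
    IsIntersecting (NonzeroVec F) S ↔
      ∀ g ∈ S, ∀ h ∈ S, Agree g.right.1 h.right.1 g.left h.left :=
  forall₄_congr fun _ _ _ _ =>
    ⟨fun ⟨v, hv⟩ => ⟨v.1, v.2, congrArg Subtype.val hv⟩,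
      fun ⟨v, hv0, hv⟩ => ⟨⟨v, hv0⟩, Subtype.ext hv⟩⟩

instance : Finite (FrobGroup p F) :=
  haveI : Finite (RingAut F) := DFunLike.finite _
  inferInstance

instance : Finite (GammaL p F) := Finite.of_equiv _ SemidirectProduct.equivProd.symm

theorem ncard_eq_sum_ncard_fiber [Fintype (FrobGroup p F)] (S : Set (GammaL p F)) :
    S.ncard = ∑ σ, (fiber S σ).ncard := by
  let e : S ≃ Σ σ, fiber S σ :=
    { toFun := fun g => ⟨g.1.right, g.1.left, g.2⟩
      invFun := fun A => ⟨⟨A.2.1, A.1⟩, A.2.2⟩ }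
  rw [← Nat.card_coe_set_eq, Nat.card_congr e, Nat.card_sigma]
  rfl

theorem isPencil_fiber_stabilizer (v : NonzeroVec F) (σ : FrobGroup p F) :
    IsPencil (fiber (MulAction.stabilizer (GammaL p F) v : Set (GammaL p F)) σ) := by
  refine ⟨σ.1 ∘ v.1, v.1, ringAut_comp_ne_zero _ v.2, v.2, .inl (Set.ext fun A => ?_)⟩
  exact Subtype.ext_iff

theorem IsIntersecting.exists_isPencil_superset_fiber (hS : IsIntersecting (NonzeroVec F) S)
    (σ : FrobGroup p F) : ∃ T, IsPencil T ∧ fiber S σ ⊆ T :=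
  exists_isPencil_superset fun A hA B hB =>
    (isIntersecting_iff_agree.mp hS ⟨A, σ⟩ hA ⟨B, σ⟩ hB).det_sub_eq_zero

theorem ncard_of_isPencil_fiber (hS : ∀ σ, IsPencil (fiber S σ)) :
    S.ncard = Nat.card (FrobGroup p F) * (Nat.card F * (Nat.card F - 1)) := by
  have := Fintype.ofFinite (FrobGroup p F)
  rw [ncard_eq_sum_ncard_fiber, Finset.sum_congr rfl fun σ _ => (hS σ).ncard, Finset.sum_const,
    Finset.card_univ, smul_eq_mul, Nat.card_eq_fintype_card (α := FrobGroup p F)]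

theorem card_stabilizer_nonzeroVec (v : NonzeroVec F) :
    Nat.card (MulAction.stabilizer (GammaL p F) v) =
      Nat.card (FrobGroup p F) * (Nat.card F * (Nat.card F - 1)) :=
  ncard_of_isPencil_fiber (isPencil_fiber_stabilizer v)

theorem IsIntersecting.exists_superset_isPencil_fiber (hS : IsIntersecting (NonzeroVec F) S) :
    ∃ T, S ⊆ T ∧ ∀ σ, IsPencil (fiber T σ) := by
  choose T hT hST using hS.exists_isPencil_superset_fiber
  exact ⟨{g | g.left ∈ T g.right}, fun g hg => hST g.right hg, hT⟩

variable (p F) in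
theorem hasEKR_gammaL : HasEKR (GammaL p F) (NonzeroVec F) := fun S hS v => by
  obtain ⟨T, hST, hT⟩ := hS.exists_superset_isPencil_fiber
  rw [card_stabilizer_nonzeroVec, ← ncard_of_isPencil_fiber hT]
  exact Set.ncard_le_ncard hST

theorem isMaximumIntersecting_iff_isPencil_fiber :
    IsMaximumIntersecting (NonzeroVec F) S ↔
      IsIntersecting (NonzeroVec F) S ∧ ∀ σ, IsPencil (fiber S σ) := by
  have h1 : (![1, 0] : Fin 2 → F) ≠ 0 := by simp
  rw [(hasEKR_gammaL p F).isMaximumIntersecting_iff ⟨_, h1⟩, card_stabilizer_nonzeroVec]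
  refine and_congr_right fun hS => ⟨fun hcard => ?_, ncard_of_isPencil_fiber⟩
  obtain ⟨T, hST, hT⟩ := hS.exists_superset_isPencil_fiber
  rwa [Set.eq_of_subset_of_ncard_le hST (by rw [hcard, ncard_of_isPencil_fiber hT])]

end SemilinearGroup

section LinearFamilies

open Matrix

theorem detTwist_entrywise {F : Type*} [Field F] (σ : RingAut F) (A : GL (Fin 2) F) :
    detTwist (entrywise F σ A) = entrywise F σ (detTwist A) := by
  have hdet : (σ.mapMatrix A.1).det = σ A.1.det := (RingEquiv.map_det σ A.1).symm
  refine Units.ext ?_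
  calc (detTwist (entrywise F σ A)).1 = (σ.mapMatrix A.1).det⁻¹ • σ.mapMatrix A.1 :=
        coe_detTwist _
    _ = σ.mapMatrix (A.1.det⁻¹ • A.1) := by
        rw [hdet]
        ext i j
        simp only [Matrix.smul_apply, RingEquiv.mapMatrix_apply, map_apply, smul_eq_mul,
          map_mul, map_inv₀]
    _ = (entrywise F σ (detTwist A)).1 := by
        rw [← coe_detTwist]
        rfl

variable {p : ℕ} [Fact p.Prime] {F : Type*} [Field F] [Fintype F] [CharP F p]
  {S : Set (GammaL p F)} {a : FrobGroup p F → Fˣ}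

variable (p F) in
/-- The involution of `ΓL(2, F)` that extends `detTwist` and fixes the field automorphisms. It
interchanges the two types of maximum intersecting sets. -/
noncomputable def semilinearTwist : GammaL p F →* GammaL p F :=
  SemidirectProduct.map detTwist (MonoidHom.id _) fun σ =>
    MonoidHom.ext fun A => detTwist_entrywise σ.1 A

theorem semilinearTwist_involutive : Function.Involutive (semilinearTwist p F) := fun g =>
  SemidirectProduct.ext (detTwist_involutive g.left) rfl

theorem fiber_image_semilinearTwist (S : Set (GammaL p F)) (σ : FrobGroup p F) :
    fiber (semilinearTwist p F '' S) σ = detTwist ⁻¹' fiber S σ := by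
  rw [semilinearTwist_involutive.image_eq_preimage_symm]
  rfl

theorem IsMaximumIntersecting.image_semilinearTwist
    (hS : IsMaximumIntersecting (NonzeroVec F) S) :
    IsMaximumIntersecting (NonzeroVec F) (semilinearTwist p F '' S) := by
  refine hS.image_of_injective semilinearTwist_involutive.injective ?_
  rw [semilinearTwist_involutive.image_eq_preimage_symm, isIntersecting_iff_agree]
  exact fun g hg h hh => (isIntersecting_iff_agree.mp hS.1 _ hg _ hh).of_detTwist

/-- The elements `a_σ σ` of `ΓL(1, F)` form an intersecting set on the nonzero scalars. -/
def Compatible (a : FrobGroup p F → Fˣ) : Prop :=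
  ∀ σ τ, ∃ c ≠ 0, (a σ : F) * σ.1 c = a τ * τ.1 c

theorem Compatible.inv (ha : Compatible a) : Compatible a⁻¹ := fun σ τ => by
  obtain ⟨c, hc, h⟩ := ha σ τ
  refine ⟨c⁻¹, inv_ne_zero hc, ?_⟩
  rw [Pi.inv_apply, Pi.inv_apply, Units.val_inv_eq_inv_val, Units.val_inv_eq_inv_val, map_inv₀,
    map_inv₀, ← mul_inv, h, mul_inv]

/-- The elements of `ΓL(2, F)` over each `σ` that take the first basis vector to its multiple by
`a_σ`: the union of the sets `V_{i,j}`, where `a_σ = ω ^ i` at `σ = φ ^ j`. -/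
def vertSet (a : FrobGroup p F → Fˣ) : Set (GammaL p F) :=
  {g | g.left ∈ transporter ![1, 0] ![(a g.right : F), 0]}

/-- The elements of `ΓL(2, F)` over each `σ` whose matrix has second row `(0, d_σ)`: the union of
the sets `H_{t,j}`, where `d_σ = σ (ω ^ t)` at `σ = φ ^ j`. -/
def horSet (d : FrobGroup p F → Fˣ) : Set (GammaL p F) :=
  {g | g.left ∈ cotransporter ![0, 1] ![0, (d g.right : F)]}

theorem horSet_eq_image_semilinearTwist (d : FrobGroup p F → Fˣ) :
    horSet d = semilinearTwist p F '' vertSet d⁻¹ := by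
  rw [semilinearTwist_involutive.image_eq_preimage_symm]
  ext g
  set d₀ := d g.right
  have hperp : perp ![0, (d₀ : F)] = d₀ • ![1, 0] :=
    vec2_eq_iff.mpr (by simp [perp, Units.smul_def])
  have hperp1 : perp ![0, (1 : F)] = d₀ • ![((d₀⁻¹ : Fˣ) : F), 0] :=
    vec2_eq_iff.mpr (by simp [perp, Units.smul_def])
  calc g.left ∈ cotransporter ![0, 1] ![0, (d₀ : F)]
      ↔ (detTwist g.left).1 *ᵥ (d₀ • ![1, 0]) = d₀ • ![((d₀⁻¹ : Fˣ) : F), 0] := by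
        rw [cotransporter_eq_preimage_detTwist, hperp, hperp1]
        rfl
    _ ↔ (detTwist g.left).1 *ᵥ ![1, 0] = ![((d₀⁻¹ : Fˣ) : F), 0] := by
        rw [mulVec_smul, smul_left_cancel_iff]

theorem Compatible.isMaximumIntersecting_vertSet (ha : Compatible a) :
    IsMaximumIntersecting (NonzeroVec F) (vertSet a) := by
  refine isMaximumIntersecting_iff_isPencil_fiber.mpr
    ⟨isIntersecting_iff_agree.mpr fun g hg h hh => ?_, fun σ =>
      ⟨![1, 0], ![(a σ : F), 0], by simp, by simp, .inl rfl⟩⟩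
  obtain ⟨c, hc, hgh⟩ := ha g.right h.right
  have hcomp : ∀ σ : RingAut F, σ ∘ ![c, 0] = σ c • ![1, 0] := fun σ =>
    vec2_eq_iff.mpr (by simp)
  have hg' : g.left.1 *ᵥ ![1, 0] = ![(a g.right : F), 0] := hg
  have hh' : h.left.1 *ᵥ ![1, 0] = ![(a h.right : F), 0] := hh
  refine ⟨![c, 0], by simpa, ?_⟩
  rw [hcomp, hcomp, mulVec_smul, mulVec_smul, hg', hh', vec2_eq_iff]
  simpa [mul_comm] using hgh

theorem Compatible.isMaximumIntersecting_horSet (ha : Compatible a) :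
    IsMaximumIntersecting (NonzeroVec F) (horSet a) := by
  rw [horSet_eq_image_semilinearTwist]
  exact ha.inv.isMaximumIntersecting_vertSet.image_semilinearTwist

theorem compatible_of_isIntersecting_vertSet (h2 : (2 : F) ≠ 0)
    (hS : IsIntersecting (NonzeroVec F) (vertSet a)) : Compatible a := fun σ τ => by
  obtain ⟨y, hy⟩ := exists_unit_forall_eq_zero_of_mul_eq h2 (L := τ.1) (M := σ.1)
    (map_neg τ.1) (map_neg σ.1) fun _ => (map_eq_zero σ.1).mp
  have hmem : ∀ ρ x, (⟨upperTri (a ρ) 0 x, ρ⟩ : GammaL p F) ∈ vertSet a := fun ρ x => by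
    simp [vertSet, transporter, coe_upperTri]
  obtain ⟨v, hv, h⟩ := isIntersecting_iff_agree.mp hS _ (hmem σ 1) _ (hmem τ y)
  rw [coe_upperTri, coe_upperTri, mulVec_vec2, mulVec_vec2, vec2_eq_iff] at h
  have hv1 : v 1 = 0 := hy _ (by simpa using h.2.symm)
  exact ⟨v 0, fun hv0 => hv (vec2_eq_iff.mpr ⟨hv0, hv1⟩), by simpa using h.1⟩

end LinearFamilies

section NormalForm

open Matrix

variable {p : ℕ} [Fact p.Prime] {F : Type*} [Field F] [Fintype F] [CharP F p]
  {S : Set (GammaL p F)}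

theorem IsMaximumIntersecting.exists_eq_vertSet (h2 : (2 : F) ≠ 0)
    (hS : IsMaximumIntersecting (NonzeroVec F) S)
    (h1 : fiber S 1 = transporter ![1, 0] ![1, 0]) :
    ∃ a, a 1 = 1 ∧ Compatible a ∧ S = vertSet a := by
  obtain ⟨hint, hpencil⟩ := isMaximumIntersecting_iff_isPencil_fiber.mp hS
  choose a ha using fun σ => (hpencil σ).exists_eq_transporter_of_agree h2 fun A hA B hB =>
    isIntersecting_iff_agree.mp hint ⟨A, 1⟩ (h1.symm.subset hA) ⟨B, σ⟩ hB
  obtain rfl : S = vertSet a := Set.ext fun g => Set.ext_iff.mp (ha g.right) g.left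
  refine ⟨a, Units.ext ?_, compatible_of_isIntersecting_vertSet h2 hint, rfl⟩
  have hone : (1 : GL (Fin 2) F) ∈ fiber (vertSet a) 1 := h1 ▸ one_mulVec _
  have h : ![(1 : F), 0] = ![(a 1 : F), 0] := (one_mulVec _).symm.trans hone
  exact (congrFun h 0).symm

theorem fiber_one_image_conj_ofGL (g : GL (Fin 2) F) (S : Set (GammaL p F)) :
    fiber (MulAut.conj (ofGL p g) '' S) 1 = (fun A => g * A * g⁻¹) '' fiber S 1 := by
  have hconj : ∀ A : GL (Fin 2) F, MulAut.conj (ofGL p g) ⟨A, 1⟩ = ⟨g * A * g⁻¹, 1⟩ := fun A =>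
    (show ofGL p g * ofGL p A * (ofGL p g)⁻¹ = ofGL p (g * A * g⁻¹) by
      simp only [ofGL, map_mul, map_inv])
  ext B
  constructor
  · rintro ⟨⟨A, σ⟩, hA, h⟩
    obtain rfl : σ = 1 := by simpa [ofGL] using congrArg SemidirectProduct.right h
    exact ⟨A, hA, congrArg SemidirectProduct.left ((hconj A).symm.trans h)⟩
  · rintro ⟨A, hA, rfl⟩
    exact ⟨⟨A, 1⟩, hA, hconj A⟩

theorem IsMaximumIntersecting.exists_conj_eq_vertSet (h2 : (2 : F) ≠ 0)
    (hS : IsMaximumIntersecting (NonzeroVec F) S) {u : Fin 2 → F} (hu : u ≠ 0)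
    (h1 : fiber S 1 = transporter u u) :
    ∃ g a, a 1 = 1 ∧ Compatible a ∧ MulAut.conj g '' S = vertSet a := by
  obtain ⟨A, rfl⟩ := exists_mulVec_eq hu
  refine ⟨ofGL p A⁻¹, (hS.image_of_injective (MulAut.conj _).injective
    (hS.1.image_conj _)).exists_eq_vertSet h2 ?_⟩
  rw [fiber_one_image_conj_ofGL, h1, image_mul_mul_inv_transporter, mulVec_mulVec,
    ← Units.val_mul, inv_mul_cancel, Units.val_one, one_mulVec]

theorem IsMaximumIntersecting.exists_conj_eq (h2 : (2 : F) ≠ 0)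
    (hS : IsMaximumIntersecting (NonzeroVec F) S) (h1 : 1 ∈ S) :
    ∃ g a, a 1 = 1 ∧ Compatible a ∧
      (MulAut.conj g '' S = vertSet a ∨ MulAut.conj g '' S = horSet a) := by
  obtain ⟨u, w, hu, hw, hT⟩ := (isMaximumIntersecting_iff_isPencil_fiber.mp hS).2 1
  have hone : (1 : GL (Fin 2) F) ∈ fiber S 1 := h1
  obtain hT | hT := hT
  · obtain rfl : u = w := (one_mulVec u).symm.trans (hT.subset hone)
    obtain ⟨g, a, ha1, ha, h⟩ := hS.exists_conj_eq_vertSet h2 hu hT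
    exact ⟨g, a, ha1, ha, .inl h⟩
  · obtain rfl : u = w := (vecMul_one u).symm.trans (hT.subset hone)
    obtain ⟨g, a, ha1, ha, h⟩ := hS.image_semilinearTwist.exists_conj_eq_vertSet h2
      (perp_ne_zero hu) <| by
        rw [fiber_image_semilinearTwist, hT, cotransporter_eq_preimage_detTwist,
          ← Set.preimage_comp, detTwist_involutive.comp_self, Set.preimage_id]
    refine ⟨semilinearTwist p F g, a⁻¹, by rw [Pi.inv_apply, ha1, inv_one], ha.inv, .inr ?_⟩
    rw [horSet_eq_image_semilinearTwist, inv_inv, ← h, Set.image_image, Set.image_image]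
    refine Set.image_congr fun s _ => ?_
    rw [MulAut.conj_apply, MulAut.conj_apply, map_mul, map_mul, map_inv,
      semilinearTwist_involutive s]

end NormalForm

section CyclicGroup

theorem exists_pow_mul_pow_eq_iff_dvd {G : Type*} [Group G] {ω : G}
    (hω : ∀ x, x ∈ Subgroup.zpowers ω) {N m : ℕ} (hN : orderOf ω = N) (hm : IsUnit (m : ZMod N))
    (n a b : ℕ) :
    (∃ c : G, ω ^ a * c ^ m = ω ^ b * c ^ (m * n)) ↔ (n - 1 : ZMod N) ∣ a - b := by
  have hpow : ∀ s : ℤ, ω ^ a * (ω ^ s) ^ m = ω ^ b * (ω ^ s) ^ (m * n) ↔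
      (a + s * m : ZMod N) = b + s * m * n := fun s => by
    simp only [← zpow_natCast, ← zpow_mul, ← zpow_add]
    rw [zpow_eq_zpow_iff_modEq, hN, ← ZMod.intCast_eq_intCast_iff]
    push_cast
    rw [mul_assoc]
  constructor
  · rintro ⟨c, hc⟩
    obtain ⟨s, rfl⟩ := hω c
    exact ⟨s * m, by linear_combination (hpow s).mp hc⟩
  · rintro ⟨e, he⟩
    obtain ⟨m', hm'⟩ := hm.exists_left_inv
    obtain ⟨s, hs⟩ := ZMod.intCast_surjective (e * m')
    refine ⟨ω ^ s, (hpow s).mpr ?_⟩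
    rw [hs]
    linear_combination he - (n - 1) * e * hm'

theorem pow_mod_div_mul {M : Type*} [Monoid M] {x : M} {N d e : ℕ} (hx : x ^ N = 1)
    (hd : d ∣ N) (he : d ∣ e) (s : ℕ) : x ^ (s % (N / d) * e) = x ^ (s * e) := by
  obtain ⟨e, rfl⟩ := he
  have h := ((Nat.mod_modEq s (N / d)).mul_right' d).mul_right e
  rw [Nat.div_mul_cancel hd, mul_assoc, mul_assoc] at h
  exact pow_eq_pow_of_modEq h hx

theorem orderOf_units_generator {F : Type*} [Field F] [Fintype F] {ω : Fˣ}
    (hω : ∀ x, x ∈ Subgroup.zpowers ω) : orderOf ω = Fintype.card F - 1 := by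
  rw [orderOf_eq_card_of_forall_mem_zpowers hω, Nat.card_units, Nat.card_eq_fintype_card]

theorem exponent_pos_of_card_eq_pow {α : Type*} [Fintype α] [Nontrivial α] {q k : ℕ}
    (h : Fintype.card α = q ^ k) : 0 < k := by
  refine Nat.pos_of_ne_zero ?_
  rintro rfl
  exact Fintype.one_lt_card.ne' h

end CyclicGroup

section Frobenius

variable {p : ℕ} [Fact p.Prime] {F : Type*} [Field F] [Fintype F] [CharP F p] {k : ℕ}

theorem frob_pow_apply (j : ℕ) (x : F) : (frob p F ^ j) x = x ^ p ^ j := by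
  induction j with
  | zero => simp
  | succ j ih =>
    rw [pow_succ', RingAut.mul_apply, ih, pow_succ, pow_mul]
    rfl

theorem orderOf_frob (hF : Fintype.card F = p ^ k) : orderOf (frob p F) = k := by
  let := ZMod.algebra F p
  have hk : Module.finrank (ZMod p) F = k := by
    have h := Module.card_eq_pow_finrank (K := ZMod p) (V := F)
    rw [ZMod.card, hF] at h
    exact (Nat.pow_right_injective (Fact.out : p.Prime).two_le h).symm
  rw [← hk, ← FiniteField.orderOf_frobeniusAlgEquivOfAlgebraic, orderOf_eq_orderOf_iff]
  intro n
  simp only [RingEquiv.ext_iff, AlgEquiv.ext_iff, frob_pow_apply]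
  simp [FiniteField.coe_frobeniusAlgEquivOfAlgebraic_iterate]

variable (p F) in
/-- The power `φ ^ j` of the Frobenius automorphism, in the group it generates. -/
noncomputable def frobGroupPow (j : ℕ) : FrobGroup p F := ⟨frob p F ^ j, j, zpow_natCast _ j⟩

theorem frobGroupPow_apply (j : ℕ) (x : F) : (frobGroupPow p F j).1 x = x ^ p ^ j :=
  frob_pow_apply j x

theorem bijective_frobGroupPow (hF : Fintype.card F = p ^ k) :
    Function.Bijective fun j : Fin k => frobGroupPow p F j := by
  obtain rfl := orderOf_frob hF
  have : Finite (RingAut F) := DFunLike.finite _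
  exact (finEquivZPowers (isOfFinOrder_of_finite (frob p F))).bijective

theorem exists_frobGroupPow_eq (hF : Fintype.card F = p ^ k) (σ : FrobGroup p F) :
    ∃ j < k, frobGroupPow p F j = σ :=
  let ⟨j, hj⟩ := (bijective_frobGroupPow hF).surjective σ
  ⟨j, j.2, hj⟩

theorem card_frobGroup (hF : Fintype.card F = p ^ k) : Nat.card (FrobGroup p F) = k := by
  rw [Nat.card_zpowers, orderOf_frob hF]

theorem exists_family_frobGroupPow_eq {α : Type*} (hF : Fintype.card F = p ^ k) (b : ℕ → α) :
    ∃ a : FrobGroup p F → α, ∀ j < k, a (frobGroupPow p F j) = b j :=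
  let e := Equiv.ofBijective _ (bijective_frobGroupPow (p := p) hF)
  ⟨fun σ => b (e.symm σ), fun j hj => congrArg (b ·.1) (e.symm_apply_apply ⟨j, hj⟩)⟩

end Frobenius

section Exponents

variable {p : ℕ} [Fact p.Prime] {F : Type*} [Field F] [Fintype F] [CharP F p] {k : ℕ}
  {ω : Fˣ} {a : FrobGroup p F → Fˣ} {r : ℕ → ℕ}

theorem exists_mul_frobGroupPow_eq_iff_dvd (hF : Fintype.card F = p ^ k)
    (hω : ∀ x, x ∈ Subgroup.zpowers ω) {i j : ℕ} (hij : i ≤ j) (s t : ℕ) :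
    (∃ c ≠ 0, ((ω ^ (s * (p ^ i - 1)) : Fˣ) : F) * (frobGroupPow p F i).1 c =
      (ω ^ (t * (p ^ j - 1)) : Fˣ) * (frobGroupPow p F j).1 c) ↔
    ((p : ZMod (p ^ k - 1)) ^ (j - i) - 1) ∣
      ((s : ZMod (p ^ k - 1)) * ((p : ZMod (p ^ k - 1)) ^ i - 1)
        - (t : ZMod (p ^ k - 1)) * ((p : ZMod (p ^ k - 1)) ^ j - 1)) := by
  have hcast : ∀ n, ((p ^ n - 1 : ℕ) : ZMod (p ^ k - 1)) = (p : ZMod (p ^ k - 1)) ^ n - 1 :=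
    fun n => by rw [Nat.cast_pred (Nat.pow_pos (Fact.out : p.Prime).pos), Nat.cast_pow]
  have hp : IsUnit (p : ZMod (p ^ k - 1)) :=
    .of_pow_eq_one (by rw [← sub_eq_zero, ← hcast, ZMod.natCast_self])
      (exponent_pos_of_card_eq_pow hF).ne'
  have h := exists_pow_mul_pow_eq_iff_dvd hω (hF ▸ orderOf_units_generator hω)
    (m := p ^ i) (by rw [Nat.cast_pow]; exact hp.pow i) (p ^ (j - i)) (s * (p ^ i - 1))
    (t * (p ^ j - 1))
  rw [← pow_add, Nat.add_sub_cancel' hij] at h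
  simp only [Nat.cast_mul, hcast, Nat.cast_pow] at h
  rw [← h]
  simp only [frobGroupPow_apply]
  constructor
  · rintro ⟨c, hc, hst⟩
    exact ⟨Units.mk0 c hc, Units.ext hst⟩
  · rintro ⟨c, hst⟩
    exact ⟨c, c.ne_zero, congrArg Units.val hst⟩

theorem compatible_iff_dvd (hF : Fintype.card F = p ^ k) (hω : ∀ x, x ∈ Subgroup.zpowers ω)
    (ha : ∀ j < k, a (frobGroupPow p F j) = ω ^ (r j * (p ^ j - 1))) :
    Compatible a ↔ ∀ i j, i < j → j < k →
      ((p : ZMod (p ^ k - 1)) ^ (j - i) - 1) ∣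
        ((r i : ZMod (p ^ k - 1)) * ((p : ZMod (p ^ k - 1)) ^ i - 1)
          - (r j : ZMod (p ^ k - 1)) * ((p : ZMod (p ^ k - 1)) ^ j - 1)) := by
  constructor
  · intro h i j hij hj
    rw [← exists_mul_frobGroupPow_eq_iff_dvd hF hω hij.le, ← ha i (hij.trans hj), ← ha j hj]
    exact h _ _
  · intro h σ τ
    obtain ⟨i, hi, rfl⟩ := exists_frobGroupPow_eq hF σ
    obtain ⟨j, hj, rfl⟩ := exists_frobGroupPow_eq hF τ
    wlog hij : i < j generalizing i j
    · obtain rfl | hji := (not_lt.mp hij).eq_or_lt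
      · exact ⟨1, one_ne_zero, rfl⟩
      · obtain ⟨c, hc, hcc⟩ := this j hj i hi hji
        exact ⟨c, hc, hcc.symm⟩
    rw [ha i hi, ha j hj]
    exact (exists_mul_frobGroupPow_eq_iff_dvd hF hω hij.le _ _).mpr (h i j hij hj)

theorem Compatible.exists_exponent (ha : Compatible a) (ha1 : a 1 = 1)
    (hF : Fintype.card F = p ^ k) (hω : ∀ x, x ∈ Subgroup.zpowers ω) (j : ℕ) :
    ∃ s < (p ^ k - 1) / (p ^ Nat.gcd j k - 1),
      a (frobGroupPow p F j) = ω ^ (s * (p ^ j - 1)) := by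
  have hk := exponent_pos_of_card_eq_pow hF
  have hp := (Fact.out : p.Prime).one_lt
  obtain ⟨c, hc, h⟩ := ha 1 (frobGroupPow p F j)
  obtain ⟨s, hs⟩ := (mem_powers_iff_mem_zpowers (y := (Units.mk0 c hc)⁻¹)).mpr (hω _)
  have ha' : a (frobGroupPow p F j) = ω ^ (s * (p ^ j - 1)) := by
    have h' : Units.mk0 c hc = a (frobGroupPow p F j) * Units.mk0 c hc ^ p ^ j := Units.ext <| by
      rw [frobGroupPow_apply, ha1] at h
      simpa using h
    rw [pow_mul, show ω ^ s = _ from hs, inv_pow, eq_inv_iff_mul_eq_one]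
    refine mul_right_cancel (b := Units.mk0 c hc) ?_
    rw [mul_assoc, ← pow_succ, Nat.sub_add_cancel (Nat.one_le_pow _ _ hp.le), ← h', one_mul]
  refine ⟨s % _, Nat.mod_lt _ (Nat.div_pos ?_ ?_), ?_⟩
  · exact Nat.sub_le_sub_right (Nat.pow_le_pow_right hp.le (Nat.gcd_le_right j hk)) 1
  · exact Nat.sub_pos_of_lt (Nat.one_lt_pow (Nat.gcd_pos_of_pos_right j hk).ne' hp)
  · have hω1 : ω ^ (p ^ k - 1) = 1 := by
      rw [← hF, ← orderOf_units_generator hω, pow_orderOf_eq_one]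
    rw [ha', pow_mod_div_mul hω1 (Nat.pow_sub_one_dvd_pow_sub_one p (Nat.gcd_dvd_right j k))
      (Nat.pow_sub_one_dvd_pow_sub_one p (Nat.gcd_dvd_left j k))]

theorem compatible_iff_exists_admissible (hF : Fintype.card F = p ^ k)
    (hω : ∀ x, x ∈ Subgroup.zpowers ω) :
    (a 1 = 1 ∧ Compatible a) ↔
      ∃ r, Admissible p k r ∧ ∀ j < k, a (frobGroupPow p F j) = ω ^ (r j * (p ^ j - 1)) := by
  constructor
  · rintro ⟨ha1, ha⟩
    choose r hr har using ha.exists_exponent ha1 hF hω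
    have hr0 : r 0 = 0 := Nat.lt_one_iff.mp <| (hr 0).trans_le <| by
      rw [Nat.gcd_zero_left]
      exact Nat.div_le_of_le_mul (mul_one _).ge
    exact ⟨r, ⟨hr0, fun j _ => Nat.le_sub_one_of_lt (hr j),
      (compatible_iff_dvd hF hω fun j _ => har j).mp ha⟩, fun j _ => har j⟩
  · rintro ⟨r, hr, har⟩
    refine ⟨(har 0 (exponent_pos_of_card_eq_pow hF)).trans ?_,
      (compatible_iff_dvd hF hω har).mpr hr.2.2⟩
    rw [hr.1, zero_mul, pow_zero]

end Exponents

section Types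

open Matrix

variable {F : Type*} [Field F] {σ : RingAut F} {A : GL (Fin 2) F}

theorem mul_mem_transporter_mulVec_iff {C : GL (Fin 2) F} {u w : Fin 2 → F} :
    C * A ∈ transporter u (C.1 *ᵥ w) ↔ A ∈ transporter u w := by
  change (C * A).1 *ᵥ u = C.1 *ᵥ w ↔ _
  rw [Units.val_mul, ← mulVec_mulVec]
  exact (mulVec_injective_of_isUnit C.isUnit).eq_iff

theorem entrywise_mem_transporter_iff {u w : Fin 2 → F} :
    entrywise F σ A ∈ transporter (σ ∘ u) (σ ∘ w) ↔ A ∈ transporter u w := by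
  have h : (entrywise F σ A).1 *ᵥ (σ ∘ u) = σ ∘ (A.1 *ᵥ u) :=
    funext fun i => (RingHom.map_mulVec (σ : F →+* F) A.1 u i).symm
  exact ⟨fun hA => σ.injective.comp_left (h.symm.trans hA), fun hA => h.trans (congrArg _ hA)⟩

theorem entrywise_mem_cotransporter_iff {x y : Fin 2 → F} :
    entrywise F σ A ∈ cotransporter (σ ∘ x) (σ ∘ y) ↔ A ∈ cotransporter x y := by
  have h : (σ ∘ x) ᵥ* (entrywise F σ A).1 = σ ∘ (x ᵥ* A.1) :=
    funext fun i => (RingHom.map_vecMul (σ : F →+* F) A.1 x i).symm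
  exact ⟨fun hA => σ.injective.comp_left (h.symm.trans hA), fun hA => h.trans (congrArg _ hA)⟩

theorem cotransporter_second_eq_range (y : Fˣ) :
    cotransporter ![0, 1] ![0, (y : F)] = Set.range fun xz : Fˣ × F => upperTri xz.1 xz.2 y := by
  ext A
  constructor
  · intro hA
    have hrow : A.1 1 = ![0, (y : F)] := by
      rw [← show ![0, 1] ᵥ* A.1 = ![0, (y : F)] from hA]
      simp [vecMul, dotProduct, funext_iff]
    obtain ⟨x, z, y', rfl⟩ := exists_eq_upperTri (congrFun hrow 0)
    obtain rfl : y' = y := Units.ext (congrFun hrow 1)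
    exact ⟨(x, z), rfl⟩
  · rintro ⟨⟨x, z⟩, rfl⟩
    simp [cotransporter, coe_upperTri]

variable {p : ℕ} [Fact p.Prime] [Fintype F] [CharP F p] {k : ℕ} {ω : Fˣ} {g : GammaL p F}
  {e : ℕ → ℕ} {b : FrobGroup p F → Fˣ}

theorem mem_vSet_iff {i j : ℕ} :
    g ∈ vSet p ω i j ↔ g.right = frobGroupPow p F j ∧
      g.left ∈ transporter ![1, 0] ![((ω ^ i : Fˣ) : F), 0] := by
  set σ := frobGroupPow p F j
  set c := GeneralLinearGroup.scalar (Fin 2) (ω ^ i)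
  have hσ : ∀ B, entrywise F σ.1 B ∈ transporter ![1, 0] ![1, 0] ↔
      B ∈ transporter ![1, 0] ![1, 0] := fun B => by
    have hfix : σ.1 ∘ ![1, 0] = ![1, 0] := vec2_eq_iff.mpr ⟨map_one _, map_zero _⟩
    simpa only [hfix] using entrywise_mem_transporter_iff (σ := σ.1) (u := ![1, 0]) (w := ![1, 0])
  have hc : c.1 *ᵥ ![1, 0] = ![((ω ^ i : Fˣ) : F), 0] := by
    rw [GeneralLinearGroup.coe_scalar, scalar_apply, ← smul_one_eq_diagonal, smul_mulVec,
      one_mulVec]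
    simp
  have hprod : ∀ B, ofGL p c * frobPow p F j * ofGL p B =
      ⟨c * entrywise F σ.1 B, σ⟩ := fun B => by
    rw [mul_assoc]
    exact SemidirectProduct.ext (congrArg (c * ·) (one_mul _)) (mul_one _)
  calc g ∈ vSet p ω i j
      ↔ ∃ B ∈ transporter ![1, 0] ![1, 0], g = ⟨c * entrywise F σ.1 B, σ⟩ := by
        simp only [transporter_first_eq_range, Set.exists_range_iff, Prod.exists, ← hprod]
        rfl
    _ ↔ _ := by
        constructor
        · rintro ⟨B, hB, rfl⟩
          exact ⟨rfl, by rwa [← hc, mul_mem_transporter_mulVec_iff, hσ]⟩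
        · rintro ⟨hr, hleft⟩
          obtain ⟨B, hB⟩ := (entrywise F σ.1).surjective (c⁻¹ * g.left)
          rw [eq_inv_mul_iff_mul_eq] at hB
          rw [← hc, ← hB, mul_mem_transporter_mulVec_iff, hσ] at hleft
          exact ⟨B, hleft, SemidirectProduct.ext hB.symm hr⟩

theorem mem_hSet_iff {t j : ℕ} :
    g ∈ hSet p ω t j ↔ g.right = frobGroupPow p F j ∧
      g.left ∈ cotransporter ![0, 1] ![0, (frobGroupPow p F j).1 (ω ^ t : Fˣ)] := by
  set σ := frobGroupPow p F j
  have hσ : ∀ B, entrywise F σ.1 B ∈ cotransporter ![0, 1] ![0, σ.1 (ω ^ t : Fˣ)] ↔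
      B ∈ cotransporter ![0, 1] ![0, ((ω ^ t : Fˣ) : F)] := fun B => by
    have happly : ∀ x, σ.1 ∘ ![0, x] = ![0, σ.1 x] := fun x => vec2_eq_iff.mpr ⟨map_zero _, rfl⟩
    simpa only [happly, map_one] using
      entrywise_mem_cotransporter_iff (σ := σ.1) (x := ![0, 1]) (y := ![0, ((ω ^ t : Fˣ) : F)])
  have hprod : ∀ B, frobPow p F j * ofGL p B = ⟨entrywise F σ.1 B, σ⟩ := fun B =>
    SemidirectProduct.ext (one_mul _) (mul_one _)
  calc g ∈ hSet p ω t j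
      ↔ ∃ B ∈ cotransporter ![0, 1] ![0, ((ω ^ t : Fˣ) : F)], g = ⟨entrywise F σ.1 B, σ⟩ := by
        simp only [cotransporter_second_eq_range, Set.exists_range_iff, Prod.exists, ← hprod]
        rfl
    _ ↔ _ := by
        constructor
        · rintro ⟨B, hB, rfl⟩
          exact ⟨rfl, (hσ B).mpr hB⟩
        · rintro ⟨hr, hleft⟩
          obtain ⟨B, hB⟩ := (entrywise F σ.1).surjective g.left
          rw [← hB, hσ] at hleft
          exact ⟨B, hleft, SemidirectProduct.ext hB.symm hr⟩

theorem iUnion_vSet_eq_vertSet (hF : Fintype.card F = p ^ k)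
    (hb : ∀ j < k, b (frobGroupPow p F j) = ω ^ e j) :
    ⋃ j ∈ Finset.range k, vSet p ω (e j) j = vertSet b := by
  ext g
  obtain ⟨i, hi, hg⟩ := exists_frobGroupPow_eq hF g.right
  simp only [Set.mem_iUnion, Finset.mem_range, mem_vSet_iff, exists_prop]
  constructor
  · rintro ⟨j, hj, hgj, hleft⟩
    rwa [← hb j hj, ← hgj] at hleft
  · intro hleft
    refine ⟨i, hi, hg.symm, ?_⟩
    rwa [← hb i hi, hg]

/-- The family `σ ↦ σ (b σ)`. It is the bottom right entry of `σ [x z; 0 b σ]`, where the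
paper writes the automorphism to the left of the matrix. -/
def selfApply (b : FrobGroup p F → Fˣ) : FrobGroup p F → Fˣ := fun σ =>
  Units.map (σ.1 : F →* F) (b σ)

theorem selfApply_surjective : Function.Surjective (selfApply (p := p) (F := F)) := fun d =>
  ⟨fun σ => Units.map (σ.1.symm : F →* F) (d σ),
    funext fun σ => Units.ext (σ.1.apply_symm_apply (d σ))⟩

theorem compatible_selfApply_iff : Compatible (selfApply b) ↔ Compatible b := by
  have hcomm : ∀ (σ τ : FrobGroup p F) (x : F), τ.1 (σ.1 x) = σ.1 (τ.1 x) := fun σ τ =>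
    DFunLike.congr_fun (setLike_mul_comm τ.2 σ.2)
  constructor
  · intro h σ τ
    obtain ⟨c, hc, hcc⟩ := h σ τ
    obtain ⟨d, hd⟩ := σ.1.surjective (b τ * c)
    refine ⟨d, ?_, ?_⟩
    · rintro rfl
      exact mul_ne_zero (b τ).ne_zero hc (hd.symm.trans (map_zero _))
    have hτ : τ.1 d = b σ * c := σ.1.injective <| by
      rw [← hcomm, hd, map_mul, map_mul]
      exact hcc.symm
    rw [hd, hτ]
    exact mul_left_comm _ _ _
  · intro h σ τ
    obtain ⟨c, hc, hcc⟩ := h σ τ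
    refine ⟨σ.1 c / b τ, div_ne_zero ((map_ne_zero _).mpr hc) (b τ).ne_zero, ?_⟩
    calc σ.1 (b σ) * σ.1 (σ.1 c / b τ) = σ.1 (b τ * τ.1 c / b τ) := by
          rw [← map_mul, ← mul_div_assoc, hcc]
      _ = τ.1 (b τ * (σ.1 c / b τ)) := by
          rw [mul_div_cancel_left₀ _ (b τ).ne_zero, mul_div_cancel₀ _ (b τ).ne_zero, hcomm]
      _ = τ.1 (b τ) * τ.1 (σ.1 c / b τ) := map_mul _ _ _

theorem iUnion_hSet_eq_horSet (hF : Fintype.card F = p ^ k)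
    (hb : ∀ j < k, b (frobGroupPow p F j) = ω ^ e j) :
    ⋃ j ∈ Finset.range k, hSet p ω (e j) j = horSet (selfApply b) := by
  ext g
  obtain ⟨i, hi, hg⟩ := exists_frobGroupPow_eq hF g.right
  simp only [Set.mem_iUnion, Finset.mem_range, mem_hSet_iff, exists_prop]
  constructor
  · rintro ⟨j, hj, hgj, hleft⟩
    rwa [← hb j hj, ← hgj] at hleft
  · intro hleft
    refine ⟨i, hi, hg.symm, ?_⟩
    rwa [← hb i hi, hg]

theorem isVerticalType_iff (hF : Fintype.card F = p ^ k) (hω : ∀ x, x ∈ Subgroup.zpowers ω)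
    {S : Set (GammaL p F)} :
    IsVerticalType k ω S ↔ ∃ a, a 1 = 1 ∧ Compatible a ∧ S = vertSet a := by
  constructor
  · rintro ⟨r, hr, rfl⟩
    obtain ⟨a, ha⟩ := exists_family_frobGroupPow_eq hF fun j => ω ^ (r j * (p ^ j - 1))
    obtain ⟨ha1, hac⟩ := (compatible_iff_exists_admissible hF hω).mpr ⟨r, hr, ha⟩
    exact ⟨a, ha1, hac, iUnion_vSet_eq_vertSet hF ha⟩
  · rintro ⟨a, ha1, hac, rfl⟩
    obtain ⟨r, hr, ha⟩ := (compatible_iff_exists_admissible hF hω).mp ⟨ha1, hac⟩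
    exact ⟨r, hr, (iUnion_vSet_eq_vertSet hF ha).symm⟩

theorem isHorizontalType_iff (hF : Fintype.card F = p ^ k) (hω : ∀ x, x ∈ Subgroup.zpowers ω)
    {S : Set (GammaL p F)} :
    IsHorizontalType k ω S ↔ ∃ d, d 1 = 1 ∧ Compatible d ∧ S = horSet d := by
  have hone : ∀ b : FrobGroup p F → Fˣ, selfApply b 1 = b 1 := fun b => Units.ext rfl
  constructor
  · rintro ⟨t, ht, rfl⟩
    obtain ⟨b, hb⟩ := exists_family_frobGroupPow_eq hF fun j => ω ^ (t j * (p ^ j - 1))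
    obtain ⟨hb1, hbc⟩ := (compatible_iff_exists_admissible hF hω).mpr ⟨t, ht, hb⟩
    exact ⟨selfApply b, (hone b).trans hb1, compatible_selfApply_iff.mpr hbc,
      iUnion_hSet_eq_horSet hF hb⟩
  · rintro ⟨d, hd1, hdc, rfl⟩
    obtain ⟨b, rfl⟩ := selfApply_surjective d
    obtain ⟨t, ht, hb⟩ := (compatible_iff_exists_admissible hF hω).mp
      ⟨(hone b).symm.trans hd1, compatible_selfApply_iff.mp hdc⟩
    exact ⟨t, ht, (iUnion_hSet_eq_horSet hF hb).symm⟩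

end Types

theorem theorem1 (p : ℕ) [Fact p.Prime] (hp : Odd p) (k : ℕ) (hk : 1 ≤ k)
    (F : Type*) [Field F] [Fintype F] [CharP F p] (hF : Fintype.card F = p ^ k)
    (ω : Fˣ) (hω : ∀ x : Fˣ, x ∈ Subgroup.zpowers ω) :
    -- the EKR property, and the common size of the point stabilizers
    HasEKR (GammaL p F) (NonzeroVec F) ∧
    (∀ v : NonzeroVec F,
      Nat.card (MulAction.stabilizer (GammaL p F) v) = k * p ^ k * (p ^ k - 1)) ∧
    (∀ S : Set (GammaL p F), IsIntersecting (NonzeroVec F) S →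
      S.ncard ≤ k * p ^ k * (p ^ k - 1)) ∧
    -- the maximum intersecting sets are exactly those of size `k q (q - 1)`
    (∀ S : Set (GammaL p F), IsMaximumIntersecting (NonzeroVec F) S ↔
      IsIntersecting (NonzeroVec F) S ∧ S.ncard = k * p ^ k * (p ^ k - 1)) ∧
    -- translated to contain the identity, each of them is conjugate to one of the two types
    (∀ S : Set (GammaL p F), IsMaximumIntersecting (NonzeroVec F) S → ∀ f ∈ S,
      ∃ g : GammaL p F,
        IsVerticalType k ω ((fun s => g * (f⁻¹ * s) * g⁻¹) '' S) ∨
        IsHorizontalType k ω ((fun s => g * (f⁻¹ * s) * g⁻¹) '' S)) ∧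
    -- and all sets of the two types are maximum intersecting sets
    (∀ S : Set (GammaL p F), IsVerticalType k ω S ∨ IsHorizontalType k ω S →
      IsMaximumIntersecting (NonzeroVec F) S) := by
  have h2 : (2 : F) ≠ 0 := Ring.two_ne_zero (ringChar.eq F p ▸ hp.ne_two_of_dvd_nat dvd_rfl)
  have hcard : ∀ v : NonzeroVec F,
      Nat.card (MulAction.stabilizer (GammaL p F) v) = k * p ^ k * (p ^ k - 1) := fun v => by
    rw [card_stabilizer_nonzeroVec, card_frobGroup hF, Nat.card_eq_fintype_card, hF, mul_assoc]
  let e₁ : NonzeroVec F := ⟨![1, 0], by simp⟩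
  have hEKR := hasEKR_gammaL p F
  refine ⟨hEKR, hcard, fun S hS => hcard e₁ ▸ hEKR S hS e₁,
    fun S => hcard e₁ ▸ hEKR.isMaximumIntersecting_iff e₁, fun S hS f hf => ?_, ?_⟩
  · have hmax : IsMaximumIntersecting (NonzeroVec F) ((f⁻¹ * ·) '' S) :=
      hS.image_of_injective (mul_right_injective f⁻¹) (hS.1.image_mul_left f⁻¹)
    obtain ⟨g, a, ha1, ha, hg⟩ := hmax.exists_conj_eq h2 ⟨f, hf, inv_mul_cancel f⟩
    rw [Set.image_image] at hg
    exact ⟨g, hg.imp (fun h => (isVerticalType_iff hF hω).mpr ⟨a, ha1, ha, h⟩)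
      fun h => (isHorizontalType_iff hF hω).mpr ⟨a, ha1, ha, h⟩⟩
  · rintro S (hS | hS)
    · obtain ⟨a, -, ha, rfl⟩ := (isVerticalType_iff hF hω).mp hS
      exact ha.isMaximumIntersecting_vertSet
    · obtain ⟨a, -, ha, rfl⟩ := (isHorizontalType_iff hF hω).mp hS
      exact ha.isMaximumIntersecting_horSet
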